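/- All vector lattices are real and Archimedean. Nets are indexed by nonempty directed preordered sets. A net $(x_\alpha)_{\alpha\in A}$ in a vector lattice $X$ is order convergent to $x\in X$, written $x_\alpha\xrightarrow{o}x$, if there is a net $(y_\beta)_{\beta\in B}$ in $X$, over a possibly different directed set, with $y_\beta\downarrow 0$ (decreasing with infimum $0$), such that for each $\beta\in B$ there is $\alpha_\beta\in A$ with $|x_\alpha-x|\le y_\beta$ for all $\alpha\ge\alpha_\beta$. A topological vector lattice $(X,\tau)$ is a vector lattice $X$ with a Hausdorff linear topology $\tau$ for which $0$ has a neighbourhood base of solid sets (a set $S$ is solid if $x\in S$ and $|y|\le|x|$ imply $y\in S$). Theorem. (a) Let $(X,\tau)$ be a topological vector lattice. The following are equivalent: (i) $\dim X<\infty$; (ii) for every net $(x_\alpha)$ in $X$, $x_\alpha\xrightarrow{\tau}0$ if and only if $x_\alpha\xrightarrow{o}0$. (b) Consequently, if $X$ is an infinite-dimensional vector lattice, then order convergence in $X$ is not topological: there is no topology $t$ on the set $X$ such that, for every net $(x_\alpha)$ in $X$ and every $x\in X$, $x_\alpha\xrightarrow{t}x$ if and only if $x_\alpha\xrightarrow{o}x$.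 -/

import Mathlib

open Filter Topology

universe u v

/-- A real vector lattice is Archimedean if `n x ≤ y` for all `n` forces `x ≤ 0`. (Mathlib's
class `Archimedean` is a different property: it makes every positive element a strong unit.) -/
def IsArchimedeanLattice (X : Type u) [AddCommGroup X] [Lattice X] : Prop :=
  ∀ x y : X, (∀ n : ℕ, n • x ≤ y) → x ≤ 0

/-- The net `y` decreases to `0`. -/
def DecreasesToZero {X : Type u} [AddCommGroup X] [Lattice X] {B : Type v} [Preorder B]
    (y : B → X) : Prop :=
  Antitone y ∧ IsGLB (Set.range y) 0

/-- Order convergence of the net `x` to `a`: there is a net `y` decreasing to `0`, over a possibly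
different directed set, each term of which dominates `|x - a|` on a tail. -/
def OrderConverges {X : Type u} [AddCommGroup X] [Lattice X] {A : Type v} [Preorder A]
    (x : A → X) (a : X) : Prop :=
  ∃ (B : Type u) (_ : Preorder B) (_ : IsDirectedOrder B) (_ : Nonempty B) (y : B → X),
    DecreasesToZero y ∧ ∀ b : B, ∃ i : A, ∀ j : A, i ≤ j → |x j - a| ≤ y b

/-- A topological vector lattice: a Hausdorff topological vector space over `ℝ` whose origin has a
neighbourhood base of solid sets. -/
structure IsTopologicalVectorLattice (X : Type u) [AddCommGroup X] [Lattice X] [Module ℝ X]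
    [TopologicalSpace X] : Prop where
  isTopologicalAddGroup : IsTopologicalAddGroup X
  continuousSMul : ContinuousSMul ℝ X
  t2Space : T2Space X
  locallySolid : ∀ U ∈ 𝓝 (0 : X), ∃ V ∈ 𝓝 (0 : X),
    V ⊆ U ∧ LatticeOrderedAddCommGroup.IsSolid V

/-- Order convergence is topological: some topology on `X`, with no compatibility assumed, has the
same convergent nets with the same limits. -/
def OrderConvergenceIsTopological (X : Type u) [AddCommGroup X] [Lattice X] : Prop :=
  ∃ t : TopologicalSpace X, ∀ (A : Type u) [Preorder A] [IsDirectedOrder A] [Nonempty A]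
    (x : A → X) (a : X), Tendsto x atTop (@nhds X t a) ↔ OrderConverges x a

/-!
Order convergence to `0` is compared with a topology through two facts.

In an Archimedean vector lattice every order bounded disjoint sequence order converges to `0`
(`orderConverges_zero_of_disjoint`), and if the dimension is infinite there is a disjoint sequence
of nonzero positive elements (`exists_disjoint_seq_of_not_finiteDimensional`). Suppose some topology
has the same nets converging to `0` as order convergence. Applied to the canonical net of points in
neighbourhoods of `0`, this gives a neighbourhood `U` of `0` inside an order interval `[-u, u]`.
Since `x / n` order converges to `0` for every `x`, the element `u` dominates a small multiple of
each `x`, so the terms of a disjoint sequence can be rescaled to lie in `[0, 2u]` but not in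
`[0, u]`. The rescaled sequence order converges to `0` and never enters `U`, a contradiction. No
compatibility of the topology with the vector lattice structure is used, so
`finiteDimensional_of_tendsto_iff_orderConverges` serves both for topological vector lattices and
for arbitrary topologies.

Conversely, let the dimension be finite and let `u` be the sum of the moduli of a basis. Coordinates
are continuous for any Hausdorff linear topology, so the intervals `[-ε u, ε u]` are neighbourhoods
of `0`, and topological convergence implies order convergence with dominating sequence `u / n`. For
the other direction, a net decreasing to `0` is eventually below each `ε u`
(`DecreasesToZero.exists_le_smul`), because the ideals generated by the elements `(y b - ε u)⁺`
must stabilise; local solidity does the rest.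
-/

/-! ### Disjointness and the Archimedean property -/

section Algebra

variable {X : Type u} [AddCommGroup X] [Lattice X]

theorem eq_zero_of_le_of_le_of_inf_eq_zero {p a b : X} (hp : 0 ≤ p) (ha : p ≤ a) (hb : p ≤ b)
    (hab : a ⊓ b = 0) : p = 0 :=
  le_antisymm (hab ▸ le_inf ha hb) hp

theorem inf_eq_zero_mono {a b c d : X} (ha : 0 ≤ a) (hb : 0 ≤ b) (hac : a ≤ c) (hbd : b ≤ d)
    (h : c ⊓ d = 0) : a ⊓ b = 0 :=
  le_antisymm (h ▸ inf_le_inf hac hbd) (le_inf ha hb)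

theorem add_le_of_inf_eq_zero [IsOrderedAddMonoid X] {a b y : X} (h : a ⊓ b = 0) (ha : a ≤ y) (hb : b ≤ y) :
    a + b ≤ y := by
  rw [← inf_add_sup, h, zero_add]
  exact sup_le ha hb

variable [Module ℝ X] [IsOrderedModule ℝ X]

theorem le_zero_of_forall_le_smul (hX : IsArchimedeanLattice X) {x z : X} (hx : 0 ≤ x)
    (h : ∀ n : ℕ, z ≤ (1 / ((n : ℝ) + 1)) • x) : z ≤ 0 := by
  refine hX z x fun n => ?_
  rcases n with _ | n
  · simpa using hx
  · have hn : (0 : ℝ) < (n : ℝ) + 1 := by positivity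
    have := smul_le_smul_of_nonneg_left (h n) hn.le
    rw [smul_smul, mul_one_div_cancel hn.ne', one_smul] at this
    rw [← Nat.cast_smul_eq_nsmul ℝ]
    simpa using this

variable [IsOrderedAddMonoid X]

theorem inf_smul_eq_zero {a b : X} (ha : 0 ≤ a) (hb : 0 ≤ b) (h : a ⊓ b = 0) {r s : ℝ}
    (hr : 0 ≤ r) (hs : 0 ≤ s) : (r • a) ⊓ (s • b) = 0 := by
  have hM : 0 < max r s + 1 := by positivity
  refine inf_eq_zero_mono (c := (max r s + 1) • a) (d := (max r s + 1) • b)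
    (smul_nonneg hr ha) (smul_nonneg hs hb)
    (smul_le_smul_of_nonneg_right (by linarith [le_max_left r s]) ha)
    (smul_le_smul_of_nonneg_right (by linarith [le_max_right r s]) hb) ?_
  have := (OrderIso.smulRight (β := X) hM).map_inf a b
  simpa [h] using this.symm

theorem abs_smul_le_of_abs_le {r ε : ℝ} (h : |r| ≤ ε) (x : X) : |r • x| ≤ ε • |x| := by
  have key : ∀ s : ℝ, |s| ≤ ε → s • x ≤ ε • |x| := by
    intro s hs
    refine le_trans ?_ (smul_le_smul_of_nonneg_right hs (abs_nonneg x))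
    rcases le_total 0 s with h0 | h0
    · rw [abs_of_nonneg h0]
      exact smul_le_smul_of_nonneg_left (le_abs_self x) h0
    · rw [abs_of_nonpos h0, ← neg_smul_neg]
      exact smul_le_smul_of_nonneg_left (neg_le_abs x) (neg_nonneg.2 h0)
  rw [abs_le']
  exact ⟨key r h, by rw [← neg_smul]; exact key (-r) (by rwa [abs_neg])⟩

theorem decreasesToZero_smul (hX : IsArchimedeanLattice X) {x : X} (hx : 0 ≤ x) :
    DecreasesToZero fun n : ULift.{u} ℕ => (1 / ((n.down : ℝ) + 1)) • x := by
  refine ⟨fun m n hmn => smul_le_smul_of_nonneg_right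
    (one_div_le_one_div_of_le (by positivity) ?_) hx, ?_, fun z hz => ?_⟩
  · have : (m.down : ℝ) ≤ n.down := by exact_mod_cast hmn
    linarith
  · rintro _ ⟨n, rfl⟩
    exact smul_nonneg (by positivity) hx
  · exact le_zero_of_forall_le_smul hX hx fun n => hz ⟨⟨n⟩, rfl⟩

/-- An order bounded disjoint sequence in an Archimedean vector lattice order converges to `0`. The
dominating net consists of all eventual upper bounds of the sequence. -/
theorem orderConverges_zero_of_disjoint (hX : IsArchimedeanLattice X) {x : ULift.{u} ℕ → X} {u : X}
    (hx : ∀ n, 0 ≤ x n) (hxu : ∀ n, x n ≤ u) (hd : ∀ m n, m ≠ n → x m ⊓ x n = 0) :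
    OrderConverges x 0 := by
  let D : Set X := {y | ∃ n, ∀ k, n ≤ k → x k ≤ y}
  have hu : u ∈ D := ⟨⟨0⟩, fun k _ => hxu k⟩
  have hinf : ∀ {y y' : X}, y ∈ D → y' ∈ D → y ⊓ y' ∈ D := by
    rintro y y' ⟨n, hn⟩ ⟨n', hn'⟩
    exact ⟨n ⊔ n', fun k hk => le_inf (hn k (le_sup_left.trans hk)) (hn' k (le_sup_right.trans hk))⟩
  have hD0 : ∀ y ∈ D, 0 ≤ y := fun y ⟨n, hn⟩ => (hx n).trans (hn n le_rfl)
  -- A positive lower bound `z` of `D` is disjoint from every term, because `D` contains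
  -- `(u - m • x j)⁺` for all `m`.
  have hzx : ∀ z, 0 ≤ z → (∀ y ∈ D, z ≤ y) → ∀ j, z ⊓ x j = 0 := by
    intro z hz0 hz j
    have hmem : ∀ m : ℕ, (u - m • x j) ⊔ 0 ∈ D := by
      intro m
      refine ⟨⟨j.down + 1⟩, fun k hk => ?_⟩
      have hkj : k ≠ j := by
        rintro rfl
        exact absurd (show k.down + 1 ≤ k.down from hk) (by omega)
      have h1 : (1 : ℝ) • x k ⊓ (m : ℝ) • x j = 0 :=
        inf_smul_eq_zero (hx k) (hx j) (hd k j hkj) zero_le_one m.cast_nonneg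
      rw [one_smul, Nat.cast_smul_eq_nsmul] at h1
      have h2 : x k = (x k - m • x j) ⊔ 0 := by
        rw [← sub_self (m • x j), ← sup_sub, ← add_sub_cancel_left (x k ⊓ m • x j) (x k ⊔ m • x j),
          inf_add_sup, h1]
        abel
      rw [h2]
      exact sup_le_sup_right (sub_le_sub_right (hxu k) _) _
    refine le_antisymm (hX _ u fun m => ?_) (le_inf hz0 (hx j))
    induction m with
    | zero => simpa using hD0 u hu
    | succ m ih =>
      have h1 : z ⊓ x j ≤ (u - m • (z ⊓ x j)) ⊔ 0 :=
        (inf_le_left.trans (hz _ (hmem m))).trans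
          (sup_le_sup_right (sub_le_sub_left (nsmul_le_nsmul_right inf_le_right m) _) _)
      rw [sup_eq_left.2 (sub_nonneg.2 ih)] at h1
      rw [succ_nsmul']
      exact le_sub_iff_add_le.1 h1
  -- Hence `D - z ⊆ D`, so all multiples of `z` lie below `u`.
  have hlb : ∀ z, 0 ≤ z → (∀ y ∈ D, z ≤ y) → z ≤ 0 := by
    intro z hz0 hz
    have hsub : ∀ y ∈ D, y - z ∈ D := by
      rintro y ⟨n, hn⟩
      refine ⟨n, fun k hk => le_sub_iff_add_le.2 ?_⟩
      exact add_le_of_inf_eq_zero (inf_comm z (x k) ▸ hzx z hz0 hz k) (hn k hk) (hz y ⟨n, hn⟩)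
    have hmul : ∀ m : ℕ, ∀ y ∈ D, m • z ≤ y := by
      intro m
      induction m with
      | zero => simpa using hD0
      | succ m ih =>
        intro y hy
        rw [succ_nsmul]
        exact le_sub_iff_add_le.1 (ih _ (hsub y hy))
    exact hX z u fun m => hmul m u hu
  refine ⟨Dᵒᵈ, inferInstance, ⟨fun a b => ?_⟩, ⟨OrderDual.toDual ⟨u, hu⟩⟩,
    fun d => (OrderDual.ofDual d : D), ⟨fun a b hab => hab, ?_, fun z hz => ?_⟩, ?_⟩
  · exact ⟨OrderDual.toDual ⟨_, hinf (OrderDual.ofDual a).2 (OrderDual.ofDual b).2⟩,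
      inf_le_left (α := X), inf_le_right (α := X)⟩
  · rintro _ ⟨d, rfl⟩
    exact hD0 _ (OrderDual.ofDual d).2
  · refine le_sup_left.trans (hlb (z ⊔ 0) le_sup_right fun y hy => sup_le ?_ (hD0 y hy))
    exact hz ⟨OrderDual.toDual ⟨y, hy⟩, rfl⟩
  · intro d
    obtain ⟨n, hn⟩ := (OrderDual.ofDual d).2
    refine ⟨n, fun k hk => ?_⟩
    rw [sub_zero, abs_of_nonneg (hx k)]
    exact hn k hk

/-! ### Atoms and disjoint sequences -/

/-- An atom of a vector lattice: a positive element that does not dominate two disjoint nonzero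
positive elements. (Mathlib's `IsAtom` is about covering a bottom element, which a nontrivial vector
lattice does not have.) -/
def IsLatticeAtom (a : X) : Prop :=
  0 < a ∧ ∀ b c : X, 0 ≤ b → 0 ≤ c → b ≤ a → c ≤ a → b ⊓ c = 0 → b = 0 ∨ c = 0

/-- A positive element has a component along every atom: removing a suitable multiple of the atom
leaves an element disjoint from it. The multiple is the largest one below `x`. -/
theorem IsLatticeAtom.exists_smul_le (hX : IsArchimedeanLattice X) {a x : X}
    (ha : IsLatticeAtom a) (hx : 0 ≤ x) : ∃ t : ℝ, 0 ≤ t ∧ t • a ≤ x ∧ (x - t • a) ⊓ a = 0 := by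
  have ha0 := ha.1.le
  let S : Set ℝ := {t | t • a ≤ x}
  have hS0 : (0 : ℝ) ∈ S := by simpa [S] using hx
  have hbdd : BddAbove S := by
    by_contra hb
    refine ha.1.not_ge (hX a x fun n => ?_)
    obtain ⟨t, ht, hnt⟩ := not_bddAbove_iff.1 hb n
    rw [← Nat.cast_smul_eq_nsmul ℝ]
    exact (smul_le_smul_of_nonneg_right hnt.le ha0).trans ht
  have hle : sSup S • a ≤ x := by
    refine sub_nonpos.1 (le_zero_of_forall_le_smul hX ha0 fun n => ?_)
    obtain ⟨t, ht, hnt⟩ := exists_lt_of_lt_csSup ⟨0, hS0⟩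
      (sub_lt_self (sSup S) (show (0 : ℝ) < 1 / (n + 1) by positivity))
    have h1 : (sSup S - 1 / ((n : ℝ) + 1)) • a ≤ x :=
      (smul_le_smul_of_nonneg_right hnt.le ha0).trans ht
    rw [sub_smul] at h1
    exact sub_le_comm.1 h1
  refine ⟨sSup S, le_csSup hbdd hS0, hle, ?_⟩
  have hx' : 0 ≤ x - sSup S • a := sub_nonneg.2 hle
  set w := (x - sSup S • a) ⊓ a with hw
  have hw0 : 0 ≤ w := le_inf hx' ha0
  refine le_antisymm (le_zero_of_forall_le_smul hX ha0 fun n => ?_) hw0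
  set ε : ℝ := 1 / ((n : ℝ) + 1) with hε
  have hε0 : 0 < ε := by positivity
  have hε1 : ε ≤ 1 := by
    rw [hε, div_le_one (by positivity)]
    linarith [(n.cast_nonneg : (0 : ℝ) ≤ n)]
  have hεa : 0 ≤ ε • a := smul_nonneg hε0.le ha0
  have hεa1 : ε • a ≤ a := by simpa using smul_le_smul_of_nonneg_right hε1 ha0
  rcases ha.2 (w - ε • a)⁺ (w - ε • a)⁻ (posPart_nonneg _) (negPart_nonneg _)
    (sup_le ((sub_le_self _ hεa).trans inf_le_right) ha0)
    (sup_le (by rw [neg_sub]; exact (sub_le_self _ hw0).trans hεa1) ha0)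
    (posPart_inf_negPart_eq_zero _) with h | h
  · exact sub_nonpos.1 (posPart_eq_zero.1 h)
  · -- Here `ε • a ≤ x - sSup S • a`, against the maximality of `sSup S`.
    have h1 : ε • a ≤ x - sSup S • a := (sub_nonneg.1 (negPart_eq_zero.1 h)).trans inf_le_left
    have h2 : sSup S + ε ∈ S := by
      change (sSup S + ε) • a ≤ x
      rw [add_smul, add_comm]
      exact le_sub_iff_add_le.1 h1
    linarith [le_csSup hbdd h2]

omit [Module ℝ X] [IsOrderedModule ℝ X] [IsOrderedAddMonoid X] in
/-- Below a positive element that dominates no atom, disjoint elements can be split off forever. -/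
theorem exists_disjoint_seq_of_no_atom {x : X} (hx : 0 < x)
    (h : ∀ a, a ≤ x → ¬ IsLatticeAtom a) :
    ∃ f : ℕ → X, (∀ n, 0 < f n) ∧ ∀ m n, m ≠ n → f m ⊓ f n = 0 := by
  let P := {y : X // 0 < y ∧ y ≤ x}
  have hsplit : ∀ y : P, ∃ b : X, ∃ c : P, 0 < b ∧ b ≤ y.1 ∧ c.1 ≤ y.1 ∧ b ⊓ c.1 = 0 := by
    rintro ⟨y, hy0, hyx⟩
    have := h y hyx
    simp only [IsLatticeAtom, not_and, not_forall, not_or] at this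
    obtain ⟨b, c, hb, hc, hby, hcy, hbc, hb0, hc0⟩ := this hy0
    exact ⟨b, ⟨c, lt_of_le_of_ne hc (Ne.symm hc0), hcy.trans hyx⟩,
      lt_of_le_of_ne hb (Ne.symm hb0), hby, hcy, hbc⟩
  choose b c hb0 hby hcy hbc using hsplit
  let g : ℕ → P := fun n => c^[n] ⟨x, hx, le_rfl⟩
  have hg : ∀ n, g (n + 1) = c (g n) := fun n => Function.iterate_succ_apply' c n _
  have hanti : Antitone fun n => (g n).1 := antitone_nat_of_succ_le fun n => by
    rw [hg]
    exact hcy _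
  have hlt : ∀ m n, m < n → b (g m) ⊓ b (g n) = 0 := fun m n hmn =>
    inf_eq_zero_mono (hb0 _).le (hb0 _).le le_rfl
      ((hby (g n)).trans ((hanti (Nat.succ_le_of_lt hmn)).trans (congrArg Subtype.val (hg m)).le))
      (hbc (g m))
  refine ⟨fun n => b (g n), fun n => hb0 _, fun m n hmn => ?_⟩
  rcases lt_or_gt_of_ne hmn with hlt' | hlt'
  · exact hlt m n hlt'
  · rw [inf_comm]
    exact hlt n m hlt'

/-- Subtracting components along finitely many atoms one at a time leaves a positive element
disjoint from all of them. -/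
theorem exists_mem_span_sub_inf_eq_zero (hX : IsArchimedeanLattice X) {x : X} (hx : 0 ≤ x)
    (s : Finset X) (hs : ∀ a ∈ s, IsLatticeAtom a) :
    ∃ z ∈ Submodule.span ℝ (s : Set X), z ≤ x ∧ ∀ a ∈ s, (x - z) ⊓ a = 0 := by
  classical
  induction s using Finset.induction_on with
  | empty => exact ⟨0, zero_mem _, hx, by simp⟩
  | insert a s _ ih =>
    obtain ⟨z, hz, hzx, hd⟩ := ih fun b hb => hs b (Finset.mem_insert_of_mem hb)
    obtain ⟨t, ht0, htx, hta⟩ :=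
      (hs a (Finset.mem_insert_self a s)).exists_smul_le hX (sub_nonneg.2 hzx)
    have hsub : x - (z + t • a) = x - z - t • a := by abel
    refine ⟨z + t • a, add_mem (Submodule.span_mono (by simp) hz)
      (Submodule.smul_mem _ _ (Submodule.subset_span (by simp))), ?_, ?_⟩
    · rw [← sub_nonneg, hsub]
      exact sub_nonneg.2 htx
    · intro b hb
      have hb0 : 0 ≤ b := (hs b hb).1.le
      rw [hsub]
      rcases Finset.mem_insert.1 hb with rfl | hb
      · exact hta
      · exact inf_eq_zero_mono (sub_nonneg.2 htx) hb0
          (sub_le_self _ (smul_nonneg ht0 (hs a (Finset.mem_insert_self a s)).1.le)) le_rfl (hd b hb)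

/-- An infinite-dimensional Archimedean vector lattice contains an infinite disjoint sequence:
otherwise finitely many atoms meet every positive element and span the whole space. -/
theorem exists_disjoint_seq_of_not_finiteDimensional (hX : IsArchimedeanLattice X)
    (hfin : ¬ FiniteDimensional ℝ X) :
    ∃ f : ℕ → X, (∀ n, 0 < f n) ∧ ∀ m n, m ≠ n → f m ⊓ f n = 0 := by
  by_contra hno
  have hatom : ∀ x : X, 0 < x → ∃ a, a ≤ x ∧ IsLatticeAtom a := by
    intro x hx
    by_contra! h
    exact hno (exists_disjoint_seq_of_no_atom hx h)
  obtain ⟨s, hs, hmax⟩ : ∃ s : Finset X, (∀ a ∈ s, IsLatticeAtom a) ∧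
      ∀ b, IsLatticeAtom b → ∃ a ∈ s, a ⊓ b ≠ 0 := by
    by_contra! h
    have : Std.Symm fun a b : X => a ⊓ b = 0 := ⟨fun a b hab => by rwa [inf_comm]⟩
    obtain ⟨f, hf, hd⟩ := exists_seq_of_forall_finset_exists' IsLatticeAtom
      (fun a b : X => a ⊓ b = 0) h
    exact hno ⟨f, fun n => (hf n).1, fun m n hmn => hd hmn⟩
  have hpos : ∀ x : X, 0 ≤ x → x ∈ Submodule.span ℝ (s : Set X) := by
    intro x hx
    obtain ⟨z, hz, hzx, hd⟩ := exists_mem_span_sub_inf_eq_zero hX hx s hs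
    rcases (sub_nonneg.2 hzx).eq_or_lt with h0 | h0
    · rwa [sub_eq_zero.1 h0.symm]
    · obtain ⟨b, hb, hba⟩ := hatom _ h0
      obtain ⟨a, ha, hab⟩ := hmax b hba
      refine absurd ?_ hab
      rw [inf_comm]
      exact inf_eq_zero_mono hba.1.le (hs a ha).1.le hb le_rfl (hd a ha)
  refine hfin ⟨⟨s, eq_top_iff.2 fun x _ => ?_⟩⟩
  rw [← posPart_sub_negPart x]
  exact sub_mem (hpos _ (posPart_nonneg x)) (hpos _ (negPart_nonneg x))

/-! ### Topologies that capture order convergence -/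

/-- The index set of the canonical net of `0`: a neighbourhood of `0` together with a point in it. -/
structure NhdsZeroPoint (X : Type u) [Zero X] [TopologicalSpace X] : Type u where
  carrier : Set X
  point : X
  carrier_mem_nhds : carrier ∈ 𝓝 0
  point_mem : point ∈ carrier

/-- Only the neighbourhoods are compared, by reverse inclusion; the points play no part. -/
instance (X : Type u) [Zero X] [TopologicalSpace X] : Preorder (NhdsZeroPoint X) :=
  Preorder.lift fun p => OrderDual.toDual p.carrier

instance (X : Type u) [Zero X] [TopologicalSpace X] : IsDirectedOrder (NhdsZeroPoint X) :=
  ⟨fun p q =>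
    have h := inter_mem p.carrier_mem_nhds q.carrier_mem_nhds
    ⟨⟨p.carrier ∩ q.carrier, 0, h, mem_of_mem_nhds h⟩,
      show _ ⊆ p.carrier from Set.inter_subset_left,
      show _ ⊆ q.carrier from Set.inter_subset_right⟩⟩

instance (X : Type u) [Zero X] [TopologicalSpace X] : Nonempty (NhdsZeroPoint X) :=
  ⟨⟨Set.univ, 0, univ_mem, trivial⟩⟩

omit [Module ℝ X] [IsOrderedModule ℝ X] [IsOrderedAddMonoid X] in
/-- If a topology, not assumed compatible with any other structure, has the same nets converging to
`0` as order convergence, then some neighbourhood of `0` is order bounded. -/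
theorem exists_nhds_zero_abs_le [TopologicalSpace X]
    (h : ∀ (A : Type u) [Preorder A] [IsDirectedOrder A] [Nonempty A] (x : A → X),
      Tendsto x atTop (𝓝 0) ↔ OrderConverges x 0) :
    ∃ U ∈ 𝓝 (0 : X), ∃ u : X, ∀ x ∈ U, |x| ≤ u := by
  have ht : Tendsto (fun p : NhdsZeroPoint X => p.point) atTop (𝓝 0) := by
    intro U hU
    refine mem_atTop_sets.2 ⟨⟨U, 0, hU, mem_of_mem_nhds hU⟩, fun q hq => ?_⟩
    exact (show q.carrier ⊆ U from hq) q.point_mem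
  obtain ⟨B, _, _, ⟨b⟩, y, _, hy⟩ := (h _ _).1 ht
  obtain ⟨⟨U, x₀, hU, hx₀⟩, hi⟩ := hy b
  refine ⟨U, hU, y b, fun x hx => ?_⟩
  simpa using hi ⟨U, x, hU, hx⟩ (subset_refl U)

/-- A topology that captures order convergence to `0` forces the dimension to be finite. With an
order bounded neighbourhood `U ⊆ [-u, u]` of `0`, a disjoint sequence could be rescaled to lie in
`[0, 2u]` but outside `[0, u]`; it would order converge to `0` without ever entering `U`. -/
theorem finiteDimensional_of_tendsto_iff_orderConverges (hX : IsArchimedeanLattice X)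
    [TopologicalSpace X]
    (h : ∀ (A : Type u) [Preorder A] [IsDirectedOrder A] [Nonempty A] (x : A → X),
      Tendsto x atTop (𝓝 0) ↔ OrderConverges x 0) : FiniteDimensional ℝ X := by
  by_contra hfin
  obtain ⟨f, hf0, hfd⟩ := exists_disjoint_seq_of_not_finiteDimensional hX hfin
  obtain ⟨U, hU, u, hUu⟩ := exists_nhds_zero_abs_le h
  have hu : 0 ≤ u := (abs_nonneg _).trans (hUu 0 (mem_of_mem_nhds hU))
  have hscale : ∀ x : X, 0 < x → ∃ r : ℝ, 0 ≤ r ∧ r • x ≤ u + u ∧ ¬ r • x ≤ u := by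
    intro x hx
    have hdec := decreasesToZero_smul hX hx.le
    have ho : OrderConverges (fun n : ULift.{u} ℕ => (1 / ((n.down : ℝ) + 1)) • x) 0 := by
      refine ⟨ULift.{u} ℕ, inferInstance, inferInstance, inferInstance, _, hdec,
        fun n => ⟨n, fun k hk => ?_⟩⟩
      rw [sub_zero, abs_of_nonneg (hdec.2.1 ⟨k, rfl⟩)]
      exact hdec.1 hk
    obtain ⟨k, hk⟩ := (((h _ _).2 ho).eventually_mem hU).exists
    set c : ℝ := 1 / ((k.down : ℝ) + 1) with hc
    have hc0 : 0 < c := by positivity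
    have hcu : c • x ≤ u := (le_abs_self _).trans (hUu _ hk)
    have hex : ∃ m : ℕ, ¬ m • (c • x) ≤ u := by
      by_contra! hall
      exact smul_ne_zero hc0.ne' hx.ne' (le_antisymm (hX _ _ hall) (smul_nonneg hc0.le hx.le))
    classical
    -- The first multiple of `c • x` that leaves `[0, u]` is still below `2u`.
    obtain ⟨m, hm⟩ : ∃ m, Nat.find hex = m + 1 := by
      refine Nat.exists_eq_succ_of_ne_zero fun h0 => ?_
      have := Nat.find_spec hex
      rw [h0, zero_smul] at this
      exact this hu
    have hspec := Nat.find_spec hex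
    have hmin := not_not.1 (Nat.find_min hex (m := m) (by omega))
    rw [hm] at hspec
    have heq : (((m + 1 : ℕ) : ℝ) * c) • x = (m + 1) • (c • x) := by
      rw [mul_smul, Nat.cast_smul_eq_nsmul]
    refine ⟨((m + 1 : ℕ) : ℝ) * c, by positivity, ?_, by rwa [heq]⟩
    rw [heq, succ_nsmul]
    exact add_le_add hmin hcu
  choose! r hr0 hr2 hr1 using hscale
  have ho : OrderConverges (fun n : ULift.{u} ℕ => r (f n.down) • f n.down) 0 :=
    orderConverges_zero_of_disjoint hX (fun n => smul_nonneg (hr0 _ (hf0 _)) (hf0 _).le)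
      (fun n => hr2 _ (hf0 _)) fun m n hmn =>
        inf_smul_eq_zero (hf0 _).le (hf0 _).le
          (hfd _ _ fun he => hmn (ULift.down_injective he)) (hr0 _ (hf0 _)) (hr0 _ (hf0 _))
  obtain ⟨k, hk⟩ := (((h _ _).2 ho).eventually_mem hU).exists
  exact hr1 _ (hf0 _) ((le_abs_self _).trans (hUu _ hk))

/-! ### Finite dimension -/

/-- The ideal generated by a positive element `z`, as a subspace. -/
def principalIdeal (z : X) : Submodule ℝ X where
  carrier := {x | ∃ t : ℝ, 0 ≤ t ∧ |x| ≤ t • z}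
  zero_mem' := ⟨0, le_rfl, by simp⟩
  add_mem' := by
    rintro x y ⟨s, hs, hx⟩ ⟨t, ht, hy⟩
    exact ⟨s + t, add_nonneg hs ht, (abs_add_le x y).trans (by rw [add_smul]; gcongr)⟩
  smul_mem' := by
    rintro r x ⟨t, ht, hx⟩
    refine ⟨|r| * t, by positivity, (abs_smul_le_of_abs_le le_rfl x).trans ?_⟩
    rw [mul_smul]
    exact smul_le_smul_of_nonneg_left hx (abs_nonneg r)

/-- In finite dimension, a net decreasing to `0` is eventually below every positive multiple of a
strong unit `u`. Otherwise the elements `(y b - ε • u)⁺` are all nonzero; taking one of them, `z`,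
that generates an ideal of minimal dimension, `ε • u ⊓ z` is a nonzero lower bound of the net. -/
theorem DecreasesToZero.exists_le_smul [FiniteDimensional ℝ X] {B : Type v} [Preorder B]
    [IsDirectedOrder B] [Nonempty B] {y : B → X} (hy : DecreasesToZero y) {u : X} (hu0 : 0 ≤ u)
    (hu : ∀ x : X, ∃ t : ℝ, 0 ≤ t ∧ |x| ≤ t • u) {ε : ℝ} (hε : 0 < ε) : ∃ b, y b ≤ ε • u := by
  by_contra! hno
  have hy0 : ∀ b, 0 ≤ y b := fun b => hy.2.1 ⟨b, rfl⟩
  let z : B → X := fun b => (y b - ε • u)⁺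
  have hz0 : ∀ b, 0 ≤ z b := fun b => posPart_nonneg _
  have hzanti : Antitone z := fun b c hbc => posPart_mono (sub_le_sub_right (hy.1 hbc) _)
  let I : B → Submodule ℝ X := fun b => principalIdeal (z b)
  obtain ⟨_, ⟨b₀, rfl⟩, hmin⟩ := WellFounded.has_min
    (wellFounded_lt (α := Submodule ℝ X)) (Set.range I) (Set.range_nonempty I)
  have hI : ∀ b, b₀ ≤ b → I b = I b₀ := by
    intro b hb
    have hle : I b ≤ I b₀ := fun x ⟨t, ht, hx⟩ =>
      ⟨t, ht, hx.trans (smul_le_smul_of_nonneg_left (hzanti hb) ht)⟩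
    exact hle.eq_of_not_lt (hmin _ ⟨b, rfl⟩)
  have hbound : ∀ b, b₀ ≤ b → ε • u ⊓ z b₀ ≤ y b := by
    intro b hb
    have hmem : z b₀ ∈ I b := by
      rw [hI b hb]
      exact ⟨1, zero_le_one, by rw [one_smul, abs_of_nonneg (hz0 b₀)]⟩
    obtain ⟨t, ht, hzt⟩ := hmem
    rw [abs_of_nonneg (hz0 b₀)] at hzt
    have hd : (1 : ℝ) • (y b - ε • u)⁻ ⊓ t • z b = 0 :=
      inf_smul_eq_zero (negPart_nonneg _) (hz0 b)
        (by rw [inf_comm]; exact posPart_inf_negPart_eq_zero _) zero_le_one ht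
    rw [one_smul] at hd
    have h0 : (ε • u ⊓ z b₀ - y b)⁺ = 0 := by
      refine eq_zero_of_le_of_le_of_inf_eq_zero (posPart_nonneg _) ?_ ?_ hd
      · refine sup_le (le_trans ?_ le_sup_left) (negPart_nonneg _)
        rw [neg_sub]
        exact sub_le_sub_right inf_le_left _
      · exact sup_le (((sub_le_self _ (hy0 b)).trans inf_le_right).trans hzt)
          (smul_nonneg ht (hz0 b))
    exact sub_nonpos.1 (posPart_eq_zero.1 h0)
  have hinf : ε • u ⊓ z b₀ ≤ 0 := by
    refine hy.2.2 ?_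
    rintro _ ⟨b, rfl⟩
    obtain ⟨c, hbc, hc⟩ := exists_ge_ge b b₀
    exact (hbound c hc).trans (hy.1 hbc)
  have hinf0 : ε • u ⊓ z b₀ = 0 := le_antisymm hinf (le_inf (smul_nonneg hε.le hu0) (hz0 b₀))
  obtain ⟨t, ht, hzt⟩ := hu (z b₀)
  rw [abs_of_nonneg (hz0 b₀)] at hzt
  -- As `u` is a strong unit, disjointness from `ε • u` means `z b₀ = 0`.
  have hd := inf_smul_eq_zero (smul_nonneg hε.le hu0) (hz0 b₀) hinf0
    (div_nonneg ht hε.le) zero_le_one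
  rw [smul_smul, div_mul_cancel₀ _ hε.ne', one_smul] at hd
  have hz : z b₀ = 0 := eq_zero_of_le_of_le_of_inf_eq_zero (hz0 b₀) hzt le_rfl hd
  exact hno b₀ (sub_nonpos.1 (posPart_eq_zero.1 hz))

/-- A finite-dimensional vector lattice with a Hausdorff linear topology has a strong unit whose
order intervals are neighbourhoods of `0`: the sum of the moduli of a basis. -/
theorem exists_strongUnit_eventually_abs_le [FiniteDimensional ℝ X] [TopologicalSpace X]
    [IsTopologicalAddGroup X] [ContinuousSMul ℝ X] [T2Space X] :
    ∃ u : X, 0 ≤ u ∧ (∀ x : X, ∃ t : ℝ, 0 ≤ t ∧ |x| ≤ t • u) ∧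
      ∀ ε : ℝ, 0 < ε → ∀ᶠ x in 𝓝 (0 : X), |x| ≤ ε • u := by
  let b := Module.finBasis ℝ X
  have key : ∀ (x : X) (ε : ℝ), (∀ i, |b.coord i x| ≤ ε) → |x| ≤ ε • ∑ i, |b i| := by
    intro x ε hx
    calc |x| = |∑ i, b.coord i x • b i| := by simp only [b.coord_apply, b.sum_repr]
      _ ≤ ∑ i, |b.coord i x • b i| :=
        Finset.le_sum_of_subadditive (fun x : X => |x|) abs_zero.le abs_add_le _ _
      _ ≤ ∑ i, ε • |b i| := Finset.sum_le_sum fun i _ => abs_smul_le_of_abs_le (hx i) _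
      _ = ε • ∑ i, |b i| := Finset.smul_sum.symm
  refine ⟨∑ i, |b i|, Finset.sum_nonneg fun i _ => abs_nonneg _, fun x => ?_, fun ε hε => ?_⟩
  · exact ⟨∑ i, |b.coord i x|, Finset.sum_nonneg fun i _ => abs_nonneg _, key x _ fun i =>
      Finset.single_le_sum (f := fun i => |b.coord i x|) (fun i _ => abs_nonneg _)
        (Finset.mem_univ i)⟩
  · have hev : ∀ᶠ x in 𝓝 (0 : X), ∀ i, |b.coord i x| < ε := by
      refine eventually_all.2 fun i => ?_
      have hc : Continuous fun x : X => |b.coord i x| :=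
        (LinearMap.continuous_of_finiteDimensional (b.coord i)).abs
      exact hc.continuousAt.eventually_lt continuousAt_const (by simpa using hε)
    filter_upwards [hev] with x hx
    exact key x ε fun i => (hx i).le

theorem tendsto_zero_iff_orderConverges (hX : IsArchimedeanLattice X) [FiniteDimensional ℝ X]
    [TopologicalSpace X] (hτ : IsTopologicalVectorLattice X) {A : Type v} [Preorder A]
    [IsDirectedOrder A] [Nonempty A] (x : A → X) :
    Tendsto x atTop (𝓝 0) ↔ OrderConverges x 0 := by
  have := hτ.isTopologicalAddGroup
  have := hτ.continuousSMul
  have := hτ.t2Space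
  obtain ⟨u, hu0, hu, hnhds⟩ := exists_strongUnit_eventually_abs_le (X := X)
  constructor
  · intro hx
    refine ⟨ULift.{u} ℕ, inferInstance, inferInstance, inferInstance, _,
      decreasesToZero_smul hX hu0, fun n => ?_⟩
    simpa only [sub_zero] using eventually_atTop.1 (hx.eventually (hnhds _ (by positivity)))
  · rintro ⟨B, _, _, _, y, hy, hxy⟩ U hU
    obtain ⟨V, hV, hVU, hsolid⟩ := hτ.locallySolid U hU
    -- Some positive multiple of `u` lies in `V`, and solidity brings `[-ε • u, ε • u]` with it.
    have hsm : Tendsto (fun t : ℝ => t • u) (𝓝[>] 0) (𝓝 0) := by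
      have : Continuous fun t : ℝ => t • u := by fun_prop
      simpa using (this.tendsto 0).mono_left nhdsWithin_le_nhds
    obtain ⟨ε, hεV, hε⟩ := ((hsm.eventually_mem hV).and self_mem_nhdsWithin).exists
    obtain ⟨b, hb⟩ := hy.exists_le_smul hu0 hu hε
    obtain ⟨i, hi⟩ := hxy b
    refine mem_atTop_sets.2 ⟨i, fun j hij => hVU (hsolid hεV ?_)⟩
    rw [abs_of_nonneg (smul_nonneg (le_of_lt hε) hu0), ← sub_zero (x j)]
    exact (hi j hij).trans hb

end Algebra

theorem theorem2p2 {X : Type u} [AddCommGroup X] [Lattice X] [IsOrderedAddMonoid X]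
    [Module ℝ X] [IsOrderedModule ℝ X] (hX : IsArchimedeanLattice X) :
    (∀ [TopologicalSpace X], IsTopologicalVectorLattice X →
      (FiniteDimensional ℝ X ↔
        ∀ (A : Type u) [Preorder A] [IsDirectedOrder A] [Nonempty A] (x : A → X),
          Tendsto x atTop (𝓝 0) ↔ OrderConverges x 0)) ∧
    (¬ FiniteDimensional ℝ X → ¬ OrderConvergenceIsTopological X) := by
  refine ⟨fun hτ => ⟨fun _ A _ _ _ x => tendsto_zero_iff_orderConverges hX hτ x,
    finiteDimensional_of_tendsto_iff_orderConverges hX⟩, ?_⟩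
  rintro hfin ⟨t, ht⟩
  exact hfin (@finiteDimensional_of_tendsto_iff_orderConverges X _ _ _ _ _ hX t
    fun A _ _ _ x => ht A x 0)
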